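/- A smooth map $f:(M,g)\to(N,h)$ between Riemannian manifolds is called harmonic if it is a critical point of the Dirichlet energy $E[f]=\frac12\int_M\|df\|^2\,d\mathrm{Vol}_g$ (with respect to smooth compactly supported variations, the energy being taken over a compact set that contains the support of the variation; $\|\cdot\|$ is the Hilbert–Schmidt norm). A map is proper if preimages of compact sets are compact. Manifolds are smooth, without boundary and connected, and $\mathbb{R}^n$ carries its flat metric. Let $n>1$. (i) Let $(M,g)$ be a complete (not necessarily compact) connected Riemannian manifold, let $B\subset\mathbb{R}^n$ be a bounded open set, and let $f:M\to\mathbb{R}^n$ be a harmonic map that is proper as a map into $\mathbb{R}^n$ and satisfies $f(M)\subseteq B$. Then $f$ is constant. (ii) In particular, there are no bounded proper minimal surfaces in $\mathbb{R}^n$: if $M$ is a connected smooth manifold of dimension $m\ge 1$ (for surfaces, $m=2$) and $f:M\to\mathbb{R}^n$ is a proper minimal immersion, that is, a proper smooth immersion that is harmonic with respect to the induced metric $f^*h$, where $h$ is the flat metric of $\mathbb{R}^n$, then $f(M)$ is unbounded. -/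

import Mathlib

open Bundle
open scoped Manifold ContDiff

noncomputable section

namespace HarmonicMaps

/-- `√(det g)` in the chart of `M` around `x`, as a function of the coordinates `y`: the entries
`g_ij` are the inner products of the coordinate vector fields `∂_i`, `∂_j` of that chart. -/
def volumeDensity {m : ℕ} {M : Type*} [TopologicalSpace M]
    [ChartedSpace (EuclideanSpace ℝ (Fin m)) M]
    [RiemannianBundle (fun x : M => TangentSpace (𝓡 m) x)]
    (x : M) (y : EuclideanSpace ℝ (Fin m)) : ℝ :=
  let e := chartAt (EuclideanSpace ℝ (Fin m)) x
  let coordField : Fin m → TangentSpace (𝓡 m) (e.symm y) := fun i =>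
    mfderiv (𝓡 m) (𝓡 m) e.symm y (EuclideanSpace.single i (1 : ℝ))
  Real.sqrt (Matrix.det (Matrix.of fun i j => inner ℝ (coordField i) (coordField j)))

/-- The part of the Riemannian volume that lives on the domain of the chart around `x`:
`√(det g) dy¹ ⋯ dyᵐ`, transported from the range of the chart to `M`. -/
def chartVolume {m : ℕ} {M : Type*} [TopologicalSpace M]
    [ChartedSpace (EuclideanSpace ℝ (Fin m)) M]
    [RiemannianBundle (fun x : M => TangentSpace (𝓡 m) x)]
    [MeasurableSpace M] (x : M) : MeasureTheory.Measure M :=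
  let e := chartAt (EuclideanSpace ℝ (Fin m)) x
  MeasureTheory.Measure.map e.symm
    ((MeasureTheory.volume.restrict e.target).withDensity
      fun y => ENNReal.ofReal (volumeDensity x y))

/-- The Riemannian volume measure `dVol_g`. The measures `chartVolume x` agree on the overlaps of
the chart domains, so their least upper bound in the lattice of measures is the measure that
restricts to `chartVolume x` on the domain of each chart. -/
def riemannianVolume (m : ℕ) (M : Type*) [TopologicalSpace M]
    [ChartedSpace (EuclideanSpace ℝ (Fin m)) M]
    [RiemannianBundle (fun x : M => TangentSpace (𝓡 m) x)]
    [MeasurableSpace M] : MeasureTheory.Measure M :=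
  ⨆ x : M, chartVolume (m := m) x

instance {m : ℕ} {M : Type*} [TopologicalSpace M] [ChartedSpace (EuclideanSpace ℝ (Fin m)) M]
    (x : M) : FiniteDimensional ℝ (TangentSpace (𝓡 m) x) :=
  inferInstanceAs (FiniteDimensional ℝ (EuclideanSpace ℝ (Fin m)))

/-- The square `‖df‖²` of the Hilbert–Schmidt norm of the differential of `f` at `x`, i.e.
`∑ i, ‖df (e_i)‖²` for an orthonormal basis `e_i` of the tangent space at `x`. -/
def hilbertSchmidtSq (m n : ℕ)
    {M : Type*} [TopologicalSpace M] [ChartedSpace (EuclideanSpace ℝ (Fin m)) M]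
    [RiemannianBundle (fun x : M => TangentSpace (𝓡 m) x)]
    {N : Type*} [TopologicalSpace N] [ChartedSpace (EuclideanSpace ℝ (Fin n)) N]
    [RiemannianBundle (fun y : N => TangentSpace (𝓡 n) y)] (f : M → N) (x : M) : ℝ :=
  ∑ i, ‖mfderiv (𝓡 m) (𝓡 n) f x (stdOrthonormalBasis ℝ (TangentSpace (𝓡 m) x) i)‖ ^ 2

/-- The Dirichlet energy `½ ∫_K ‖df‖² dVol_g` of `f` over `K`. -/
def dirichletEnergy (m n : ℕ)
    {M : Type*} [TopologicalSpace M] [ChartedSpace (EuclideanSpace ℝ (Fin m)) M]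
    [RiemannianBundle (fun x : M => TangentSpace (𝓡 m) x)] [MeasurableSpace M]
    {N : Type*} [TopologicalSpace N] [ChartedSpace (EuclideanSpace ℝ (Fin n)) N]
    [RiemannianBundle (fun y : N => TangentSpace (𝓡 n) y)] (K : Set M) (f : M → N) : ℝ :=
  (1 / 2) * ∫ x in K, hilbertSchmidtSq m n f x ∂(riemannianVolume m M)

/-- A harmonic map: a smooth map that is a critical point of the Dirichlet energy, with respect to
all smooth variations `F t` of `f = F 0` that are supported in a compact set `K` (the energy over
all of `M` may be infinite, and the part outside `K` does not change). -/
def IsHarmonic (m n : ℕ)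
    {M : Type*} [TopologicalSpace M] [ChartedSpace (EuclideanSpace ℝ (Fin m)) M]
    [RiemannianBundle (fun x : M => TangentSpace (𝓡 m) x)] [MeasurableSpace M]
    {N : Type*} [TopologicalSpace N] [ChartedSpace (EuclideanSpace ℝ (Fin n)) N]
    [RiemannianBundle (fun y : N => TangentSpace (𝓡 n) y)] (f : M → N) : Prop :=
  ContMDiff (𝓡 m) (𝓡 n) ∞ f ∧
    ∀ (F : ℝ → M → N) (K : Set M),
      ContMDiff (𝓘(ℝ, ℝ).prod (𝓡 m)) (𝓡 n) ∞ (fun p : ℝ × M => F p.1 p.2) →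
      F 0 = f → IsCompact K → (∀ t, ∀ x ∉ K, F t x = f x) →
      HasDerivAt (fun t => dirichletEnergy m n K (F t)) 0 0

/-- A minimal immersion: a smooth immersion `f : M → (N, h)` that is harmonic with respect to the
induced metric `g = f^*h` on `M`. -/
def IsMinimalImmersion (m n : ℕ)
    {M : Type*} [TopologicalSpace M] [ChartedSpace (EuclideanSpace ℝ (Fin m)) M]
    [IsManifold (𝓡 m) ∞ M] [MeasurableSpace M]
    {N : Type*} [TopologicalSpace N] [ChartedSpace (EuclideanSpace ℝ (Fin n)) N]
    [RiemannianBundle (fun y : N => TangentSpace (𝓡 n) y)] (f : M → N) : Prop :=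
  ContMDiff (𝓡 m) (𝓡 n) ∞ f ∧
    (∀ x, Function.Injective (mfderiv (𝓡 m) (𝓡 n) f x)) ∧
    ∃ g : Bundle.ContMDiffRiemannianMetric (𝓡 m) ∞ (EuclideanSpace ℝ (Fin m))
        (fun x : M => TangentSpace (𝓡 m) x),
      (∀ (x : M) (v w : TangentSpace (𝓡 m) x), g.inner x v w =
        inner ℝ (mfderiv (𝓡 m) (𝓡 n) f x v) (mfderiv (𝓡 m) (𝓡 n) f x w)) ∧
      letI : RiemannianBundle (fun x : M => TangentSpace (𝓡 m) x) := ⟨g.toRiemannianMetric⟩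
      IsHarmonic m n f

end HarmonicMaps

end

/-! A bounded image has compact closure, so properness makes the domain, which is the preimage of
that closure, compact. On a compact domain the whole manifold may carry a variation, and the target
is a vector space, so the scaling `(1 + t) • f` is admissible. Its energy is `(1 + t)² E[f]`, with
derivative `2 E[f]` at `t = 0`; harmonicity gives `E[f] = 0`.

Zero energy forces `df = 0` everywhere once three facts are known: `‖df‖²` is continuous, the
Riemannian volume is finite on compact sets, and it is positive on nonempty open sets. Most of the
file derives these from the chart definition of the volume. Then a map with `df = 0` on a connected
manifold is constant, while an immersion of positive dimension cannot have `df = 0` at any point. -/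

noncomputable section

namespace HarmonicMaps

open MeasureTheory Set Filter
open scoped Topology ENNReal Matrix

/-! ### Gram matrices and the Hilbert–Schmidt norm -/

section LinearAlgebra

variable {m : ℕ} {V W : Type*} [NormedAddCommGroup V] [InnerProductSpace ℝ V]
  [NormedAddCommGroup W] [InnerProductSpace ℝ W]

/-- Change of variables for Gram matrices. -/
theorem gram_comp_eq (T : EuclideanSpace ℝ (Fin m) →ₗ[ℝ] V)
    (A : EuclideanSpace ℝ (Fin m) →ₗ[ℝ] EuclideanSpace ℝ (Fin m)) :
    (Matrix.of fun i j : Fin m => inner ℝ (T (A (EuclideanSpace.single i 1)))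
      (T (A (EuclideanSpace.single j 1)))) =
    (LinearMap.toMatrix (EuclideanSpace.basisFun (Fin m) ℝ).toBasis
        (EuclideanSpace.basisFun (Fin m) ℝ).toBasis A)ᵀ *
      (Matrix.of fun i j : Fin m => inner ℝ (T (EuclideanSpace.single i 1))
        (T (EuclideanSpace.single j 1))) *
      LinearMap.toMatrix (EuclideanSpace.basisFun (Fin m) ℝ).toBasis
        (EuclideanSpace.basisFun (Fin m) ℝ).toBasis A := by
  have key : ∀ v : EuclideanSpace ℝ (Fin m), T v = ∑ k, v k • T (EuclideanSpace.single k 1) := by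
    intro v
    conv_lhs => rw [← (EuclideanSpace.basisFun (Fin m) ℝ).sum_repr v]
    simp
  ext i j
  simp only [Matrix.of_apply, Matrix.mul_apply, Matrix.transpose_apply]
  rw [key (A (EuclideanSpace.single i 1)), key (A (EuclideanSpace.single j 1))]
  simp only [sum_inner, inner_sum, inner_smul_left, inner_smul_right, LinearMap.toMatrix_apply,
    Finset.sum_mul, Finset.mul_sum]
  refine Finset.sum_congr rfl fun _ _ => Finset.sum_congr rfl fun _ _ => ?_
  simp only [conj_trivial, OrthonormalBasis.coe_toBasis_repr_apply, OrthonormalBasis.coe_toBasis,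
    EuclideanSpace.basisFun_apply, EuclideanSpace.basisFun_repr]
  ring

theorem sqrt_det_gram_comp_eq (T : EuclideanSpace ℝ (Fin m) →ₗ[ℝ] V)
    (A : EuclideanSpace ℝ (Fin m) →ₗ[ℝ] EuclideanSpace ℝ (Fin m)) :
    √((Matrix.of fun i j : Fin m => inner ℝ (T (A (EuclideanSpace.single i 1)))
      (T (A (EuclideanSpace.single j 1)))).det) =
    |LinearMap.det A| * √((Matrix.of fun i j : Fin m => inner ℝ (T (EuclideanSpace.single i 1))
        (T (EuclideanSpace.single j 1))).det) := by
  rw [gram_comp_eq, Matrix.det_mul, Matrix.det_mul, Matrix.det_transpose, LinearMap.det_toMatrix,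
    mul_right_comm, ← sq, Real.sqrt_mul (sq_nonneg _), Real.sqrt_sq_eq_abs]

/-- The Hilbert–Schmidt norm in terms of an arbitrary basis `v`: it is `tr (G⁻¹ F)`, where `G` and
`F` are the Gram matrices of `v` and of its image. -/
theorem sum_norm_sq_eq_trace (b : OrthonormalBasis (Fin m) ℝ V) (v : Fin m → V)
    (L : V →ₗ[ℝ] W) (hG : (Matrix.of fun i j => (inner ℝ (v i) (v j) : ℝ)).det ≠ 0) :
    ∑ i, ‖L (b i)‖ ^ 2 =
      ((Matrix.of fun i j => (inner ℝ (v i) (v j) : ℝ))⁻¹ *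
        Matrix.of fun i j => (inner ℝ (L (v i)) (L (v j)) : ℝ)).trace := by
  set P : Matrix (Fin m) (Fin m) ℝ := Matrix.of fun k i => inner ℝ (b k) (v i) with hP
  have hv : ∀ i, v i = ∑ k, P k i • b k := fun i => (b.sum_repr' (v i)).symm
  have hGP : (Matrix.of fun i j => (inner ℝ (v i) (v j) : ℝ)) = Pᵀ * P := by
    ext i j
    simp only [Matrix.of_apply, Matrix.mul_apply, Matrix.transpose_apply, hP]
    rw [← b.sum_inner_mul_inner (v i) (v j)]
    simp only [real_inner_comm]
  have hFP : (Matrix.of fun i j => (inner ℝ (L (v i)) (L (v j)) : ℝ)) =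
      Pᵀ * (Matrix.of fun k l => (inner ℝ (L (b k)) (L (b l)) : ℝ)) * P := by
    ext i j
    simp only [Matrix.of_apply, Matrix.mul_apply, Matrix.transpose_apply]
    rw [hv i, hv j]
    simp only [map_sum, map_smul, sum_inner, inner_sum, inner_smul_left, inner_smul_right,
      Finset.sum_mul, Finset.mul_sum]
    refine Finset.sum_congr rfl fun _ _ => Finset.sum_congr rfl fun _ _ => ?_
    simp only [conj_trivial]
    ring
  -- Since `G = Pᵀ P` is invertible, so is `P`; in `G⁻¹ F` the factors `P` then cancel under the
  -- cyclic trace.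
  have hPu : IsUnit P.det := by
    rw [hGP, Matrix.det_mul] at hG
    exact (right_ne_zero_of_mul hG).isUnit
  have hPtu : IsUnit Pᵀ.det := by rwa [Matrix.det_transpose]
  rw [hFP, hGP, Matrix.mul_inv_rev, Matrix.mul_assoc Pᵀ, Matrix.mul_assoc P⁻¹,
    Matrix.nonsing_inv_mul_cancel_left _ _ hPtu, Matrix.trace_mul_comm, Matrix.mul_assoc,
    Matrix.mul_nonsing_inv _ hPu, Matrix.mul_one]
  simp [Matrix.trace]

end LinearAlgebra

/-! ### The metric and its density in charts -/

section Charts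

variable {m : ℕ} {M : Type*} [TopologicalSpace M] [ChartedSpace (EuclideanSpace ℝ (Fin m)) M]
  [RiemannianBundle (fun x : M => TangentSpace (𝓡 m) x)]

/-- The Gram matrix at `p` of the images of the standard basis under `S`. -/
def gramAt (p : M) (S : EuclideanSpace ℝ (Fin m) →L[ℝ] TangentSpace (𝓡 m) p) :
    Matrix (Fin m) (Fin m) ℝ :=
  Matrix.of fun i j => inner ℝ (S (EuclideanSpace.single i (1 : ℝ)))
    (S (EuclideanSpace.single j (1 : ℝ)))

/-- The matrix `g_ij` in the chart around `x`. -/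
def chartGram (x : M) (y : EuclideanSpace ℝ (Fin m)) : Matrix (Fin m) (Fin m) ℝ :=
  gramAt ((chartAt (EuclideanSpace ℝ (Fin m)) x).symm y)
    (mfderiv (𝓡 m) (𝓡 m) (chartAt (EuclideanSpace ℝ (Fin m)) x).symm y)

theorem volumeDensity_eq (x : M) (y : EuclideanSpace ℝ (Fin m)) :
    volumeDensity x y = √(chartGram x y).det := rfl

variable [IsManifold (𝓡 m) ∞ M]

omit [RiemannianBundle (fun x : M => TangentSpace (𝓡 m) x)] in
theorem mdifferentiable_chart_symm (x : M) :
    (chartAt (EuclideanSpace ℝ (Fin m)) x).symm.MDifferentiable (𝓡 m) (𝓡 m) :=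
  (mdifferentiable_chart x).symm

theorem det_chartGram_pos (x : M) {y : EuclideanSpace ℝ (Fin m)}
    (hy : y ∈ (chartAt (EuclideanSpace ℝ (Fin m)) x).target) : 0 < (chartGram x y).det := by
  have hli : LinearIndependent ℝ fun i : Fin m =>
      mfderiv (𝓡 m) (𝓡 m) (chartAt (EuclideanSpace ℝ (Fin m)) x).symm y
        (EuclideanSpace.single i (1 : ℝ)) := by
    have h : LinearIndependent ℝ fun i : Fin m => EuclideanSpace.single i (1 : ℝ) := by
      simpa [funext (EuclideanSpace.basisFun_apply (Fin m) ℝ)] using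
        (EuclideanSpace.basisFun (Fin m) ℝ).orthonormal.linearIndependent
    have h2 := h.map_injOn (mfderiv (𝓡 m) (𝓡 m) (chartAt (EuclideanSpace ℝ (Fin m)) x).symm
      y).toLinearMap ((mdifferentiable_chart_symm x).mfderiv_injective hy).injOn
    exact h2
  exact (Matrix.posDef_gram_of_linearIndependent hli).det_pos

theorem volumeDensity_pos (x : M) {y : EuclideanSpace ℝ (Fin m)}
    (hy : y ∈ (chartAt (EuclideanSpace ℝ (Fin m)) x).target) : 0 < volumeDensity x y :=
  Real.sqrt_pos.2 (det_chartGram_pos x hy)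

theorem continuousOn_chartGram
    [IsContinuousRiemannianBundle (EuclideanSpace ℝ (Fin m)) (fun x : M => TangentSpace (𝓡 m) x)]
    (x : M) :
    ContinuousOn (chartGram x) (chartAt (EuclideanSpace ℝ (Fin m)) x).target := by
  set e := chartAt (EuclideanSpace ℝ (Fin m)) x with he
  have hsec : ∀ i : Fin m, ContinuousOn (fun y => (⟨e.symm y, mfderiv (𝓡 m) (𝓡 m) e.symm y
      (EuclideanSpace.single i (1 : ℝ))⟩ : TotalSpace (EuclideanSpace ℝ (Fin m))
        (fun x : M => TangentSpace (𝓡 m) x))) e.target := by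
    intro i
    have h1 : ContMDiffOn (𝓡 m) (𝓡 m) ∞ e.symm e.target := contMDiffOn_chart_symm
    have h2 := h1.continuousOn_tangentMapWithin (by simp) e.open_target.uniqueMDiffOn
    have h3 : Continuous fun y : EuclideanSpace ℝ (Fin m) =>
        (⟨y, EuclideanSpace.single i (1 : ℝ)⟩ : TangentBundle (𝓡 m) (EuclideanSpace ℝ (Fin m))) := by
      exact (tangentBundleModelSpaceHomeomorph (𝓡 m)).symm.continuous.comp
        (continuous_id.prodMk continuous_const)
    have h4 := h2.comp h3.continuousOn (s := e.target) (fun y hy => hy)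
    refine h4.congr fun y hy => ?_
    simp only [tangentMapWithin, Function.comp, mfderivWithin_of_isOpen e.open_target hy]
  refine continuousOn_pi.2 fun i => continuousOn_pi.2 fun j => ?_
  exact (hsec i).inner_bundle (hsec j)

theorem continuousOn_volumeDensity
    [IsContinuousRiemannianBundle (EuclideanSpace ℝ (Fin m)) (fun x : M => TangentSpace (𝓡 m) x)]
    (x : M) :
    ContinuousOn (volumeDensity x) (chartAt (EuclideanSpace ℝ (Fin m)) x).target :=
  (Continuous.matrix_det continuous_id |>.comp_continuousOn (continuousOn_chartGram x)).sqrt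

/-- The chain rule writes the coordinate frame of one chart as that of the other composed with the
Jacobian of the transition map, and a Gram determinant scales by the square of the Jacobian
determinant. -/
theorem volumeDensity_change (x z : M) {y : EuclideanSpace ℝ (Fin m)}
    (hy : y ∈ (chartAt (EuclideanSpace ℝ (Fin m)) z).target)
    (hy' : (chartAt (EuclideanSpace ℝ (Fin m)) z).symm y ∈
      (chartAt (EuclideanSpace ℝ (Fin m)) x).source) :
    volumeDensity z y =
      |(fderiv ℝ (chartAt (EuclideanSpace ℝ (Fin m)) x ∘
        (chartAt (EuclideanSpace ℝ (Fin m)) z).symm) y).det| *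
      volumeDensity x (chartAt (EuclideanSpace ℝ (Fin m)) x
        ((chartAt (EuclideanSpace ℝ (Fin m)) z).symm y)) := by
  set e := chartAt (EuclideanSpace ℝ (Fin m)) x with he
  set d := chartAt (EuclideanSpace ℝ (Fin m)) z with hd
  have hchain : mfderiv (𝓡 m) (𝓡 m) d.symm y =
      (mfderiv (𝓡 m) (𝓡 m) e.symm (e (d.symm y))).comp (fderiv ℝ (e ∘ d.symm) y) := by
    have hev : d.symm =ᶠ[𝓝 y] e.symm ∘ (e ∘ d.symm) := by
      filter_upwards [(d.continuousAt_symm hy).preimage_mem_nhds (e.open_source.mem_nhds hy')]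
        with w hw
      exact (e.left_inv hw).symm
    rw [hev.mfderiv_eq, ← mfderiv_eq_fderiv]
    refine mfderiv_comp y ?_ ?_
    · exact (mdifferentiable_chart x).mdifferentiableAt_symm (e.map_source hy')
    · exact ((mdifferentiable_chart x).mdifferentiableAt hy').comp y
        ((mdifferentiable_chart z).mdifferentiableAt_symm hy)
  -- The base point is an explicit argument of `gramAt`, so this equation can move both Gram
  -- matrices to one tangent space.
  have hbase : e.symm (e (d.symm y)) = d.symm y := e.left_inv hy'
  have h1 : volumeDensity z y = √(gramAt (d.symm y) (mfderiv (𝓡 m) (𝓡 m) d.symm y)).det := rfl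
  have h2 : volumeDensity x (e (d.symm y)) = √(gramAt (e.symm (e (d.symm y)))
    (mfderiv (𝓡 m) (𝓡 m) e.symm (e (d.symm y)))).det := rfl
  rw [h1, h2, hchain, hbase]
  exact sqrt_det_gram_comp_eq (V := TangentSpace (𝓡 m) (d.symm y))
    (mfderiv (𝓡 m) (𝓡 m) e.symm (e (d.symm y))).toLinearMap _

end Charts

/-! ### The Riemannian volume: local finiteness and positivity -/

section Volume

variable {m : ℕ} {M : Type*} [TopologicalSpace M] [ChartedSpace (EuclideanSpace ℝ (Fin m)) M]
  [RiemannianBundle (fun x : M => TangentSpace (𝓡 m) x)] [MeasurableSpace M] [BorelSpace M]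

omit [ChartedSpace (EuclideanSpace ℝ (Fin m)) M]
  [RiemannianBundle (fun x : M => TangentSpace (𝓡 m) x)] in
theorem aemeasurable_symm_restrict_target
    (e : OpenPartialHomeomorph M (EuclideanSpace ℝ (Fin m))) :
    AEMeasurable e.symm ((volume : Measure (EuclideanSpace ℝ (Fin m))).restrict e.target) :=
  e.continuousOn_symm.aemeasurable e.open_target.measurableSet

omit [ChartedSpace (EuclideanSpace ℝ (Fin m)) M]
  [RiemannianBundle (fun x : M => TangentSpace (𝓡 m) x)] in
theorem measurableSet_target_inter_preimage
    (e : OpenPartialHomeomorph M (EuclideanSpace ℝ (Fin m))) {A : Set M} (hA : MeasurableSet A) :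
    MeasurableSet (e.target ∩ e.symm ⁻¹' A) := by
  have h := e.open_target.measurableSet.subtype_image
    (e.continuousOn_symm.domRestrict.measurable hA)
  convert h using 1
  ext y
  simp [and_comm]

theorem chartVolume_apply (x : M) {A : Set M} (hA : MeasurableSet A) :
    chartVolume (m := m) x A =
      ∫⁻ y in (chartAt (EuclideanSpace ℝ (Fin m)) x).target ∩
        (chartAt (EuclideanSpace ℝ (Fin m)) x).symm ⁻¹' A, ENNReal.ofReal (volumeDensity x y) := by
  set e := chartAt (EuclideanSpace ℝ (Fin m)) x with he
  have hae := aemeasurable_symm_restrict_target e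
  have hms := measurableSet_target_inter_preimage e hA
  have hdef : chartVolume (m := m) x = Measure.map e.symm
    ((volume.restrict e.target).withDensity fun y => ENNReal.ofReal (volumeDensity x y)) := rfl
  set μ := (volume.restrict e.target).withDensity fun y => ENNReal.ofReal (volumeDensity x y)
    with hμ
  have hac : μ ≪ volume.restrict e.target := withDensity_absolutelyContinuous _ _
  rw [hdef, Measure.map_apply_of_aemeasurable (hae.mono_ac hac) hA]
  have hcompl : μ e.targetᶜ = 0 := hac (by
    rw [Measure.restrict_apply e.open_target.measurableSet.compl]; simp)
  rw [← measure_inter_add_sdiff (e.symm ⁻¹' A) e.open_target.measurableSet,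
    show μ (e.symm ⁻¹' A \ e.target) = 0 from measure_mono_null (fun y hy => hy.2) hcompl, add_zero, inter_comm, hμ,
    withDensity_apply _ hms, Measure.restrict_restrict hms]
  congr 2
  exact inter_eq_left.2 inter_subset_left

variable [IsManifold (𝓡 m) ∞ M]

/-- On overlaps of chart domains, the chart volumes agree. -/
theorem chartVolume_eq_of_subset (x z : M) {A : Set M} (hA : MeasurableSet A)
    (hx : A ⊆ (chartAt (EuclideanSpace ℝ (Fin m)) x).source)
    (hz : A ⊆ (chartAt (EuclideanSpace ℝ (Fin m)) z).source) :
    chartVolume (m := m) z A = chartVolume (m := m) x A := by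
  set e := chartAt (EuclideanSpace ℝ (Fin m)) x with he
  set d := chartAt (EuclideanSpace ℝ (Fin m)) z with hd
  rw [chartVolume_apply z hA, chartVolume_apply x hA]
  have himg : e.target ∩ e.symm ⁻¹' A = (e ∘ d.symm) '' (d.target ∩ d.symm ⁻¹' A) := by
    ext w
    constructor
    · rintro ⟨hw, hwA⟩
      refine ⟨d (e.symm w), ⟨d.map_source (hz hwA), ?_⟩, ?_⟩
      · simpa [d.left_inv (hz hwA)] using hwA
      · simp [d.left_inv (hz hwA), e.right_inv hw]
    · rintro ⟨y, ⟨hy, hyA⟩, rfl⟩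
      refine ⟨e.map_source (hx hyA), ?_⟩
      simpa [e.left_inv (hx hyA)] using hyA
  have hms := measurableSet_target_inter_preimage d hA
  have hdiff : ∀ y ∈ d.target ∩ d.symm ⁻¹' A,
      HasFDerivWithinAt (e ∘ d.symm) (fderiv ℝ (e ∘ d.symm) y) (d.target ∩ d.symm ⁻¹' A) y := by
    rintro y ⟨hy, hyA⟩
    have : MDifferentiableAt (𝓡 m) (𝓡 m) (e ∘ d.symm) y :=
      ((mdifferentiable_chart x).mdifferentiableAt (hx hyA)).comp y
        ((mdifferentiable_chart z).mdifferentiableAt_symm hy)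
    exact this.differentiableAt.hasFDerivAt.hasFDerivWithinAt
  have hinj : InjOn (e ∘ d.symm) (d.target ∩ d.symm ⁻¹' A) :=
    e.injOn.comp (d.symm.injOn.mono inter_subset_left) fun y hy => hx hy.2
  rw [himg, lintegral_image_eq_lintegral_abs_det_fderiv_mul volume hms hdiff hinj]
  refine setLIntegral_congr_fun hms fun y hy => ?_
  simp only [volumeDensity_change x z hy.1 (hx hy.2)]
  rw [ENNReal.ofReal_mul (abs_nonneg _)]
  rfl

/-- This is the upper bound that a supremum of measures does not give for free; local finiteness
rests on it. -/
theorem riemannianVolume_le_chartVolume (x : M) {U : Set M} (hU : IsOpen U)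
    (hx : U ⊆ (chartAt (EuclideanSpace ℝ (Fin m)) x).source) :
    riemannianVolume m M U ≤ chartVolume (m := m) x U := by
  -- The comparison measure is the largest possible outside `U`, so only subsets of `U` have to be
  -- tested against each chart volume.
  have hle : riemannianVolume m M ≤
      (chartVolume (m := m) x).restrict U + (⊤ : Measure M).restrict Uᶜ := by
    refine iSup_le fun z => Measure.le_iff.2 fun A hA => ?_
    set d := chartAt (EuclideanSpace ℝ (Fin m)) z with hd
    rw [Measure.add_apply, Measure.restrict_apply hA, Measure.restrict_apply hA,
      ← measure_inter_add_sdiff A hU.measurableSet, sdiff_eq]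
    refine add_le_add ?_ (le_top (a := chartVolume (m := m) z) _)
    -- The volume of a chart gives no mass to the complement of its domain; on the rest of `A ∩ U`
    -- the two charts overlap and agree.
    have hnull : chartVolume (m := m) z ((A ∩ U) \ d.source) = 0 := by
      rw [chartVolume_apply z ((hA.inter hU.measurableSet).diff d.open_source.measurableSet)]
      have : d.target ∩ d.symm ⁻¹' ((A ∩ U) \ d.source) = ∅ := by
        ext y
        simp only [mem_inter_iff, mem_preimage, Set.mem_sdiff, mem_empty_iff_false, iff_false]
        exact fun h => h.2.2 (d.map_target h.1)
      rw [this]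
      simp
    rw [← measure_inter_add_sdiff (A ∩ U) d.open_source.measurableSet, hnull, add_zero,
      chartVolume_eq_of_subset x z ((hA.inter hU.measurableSet).inter d.open_source.measurableSet)
        (fun w hw => hx hw.1.2) inter_subset_right]
    exact measure_mono inter_subset_left
  calc riemannianVolume m M U
      ≤ ((chartVolume (m := m) x).restrict U + (⊤ : Measure M).restrict Uᶜ) U := hle U
    _ = chartVolume (m := m) x U := by
      simp [Measure.restrict_apply hU.measurableSet]

variable [IsContinuousRiemannianBundle (EuclideanSpace ℝ (Fin m))
  (fun x : M => TangentSpace (𝓡 m) x)]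

/-- Near the centre of a chart the density is bounded by continuity, and staying in a unit ball
keeps the Lebesgue measure finite. -/
instance isLocallyFiniteMeasure_riemannianVolume :
    IsLocallyFiniteMeasure (riemannianVolume m M) := by
  refine ⟨fun x => ?_⟩
  set e := chartAt (EuclideanSpace ℝ (Fin m)) x with he
  have hxs : x ∈ e.source := mem_chart_source _ x
  have hcont : ContinuousAt (volumeDensity x) (e x) :=
    (continuousOn_volumeDensity x).continuousAt (e.open_target.mem_nhds (e.map_source hxs))
  have hbd : ∀ᶠ y in 𝓝 (e x), volumeDensity x y < volumeDensity x (e x) + 1 :=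
    hcont.eventually_lt continuousAt_const (lt_add_one _)
  obtain ⟨V, hVsub, hVo, hxV⟩ := mem_nhds_iff.1
    (inter_mem (inter_mem hbd (e.open_target.mem_nhds (e.map_source hxs)))
      (Metric.ball_mem_nhds (e x) one_pos))
  have hUo : IsOpen (e.source ∩ e ⁻¹' V) := e.isOpen_inter_preimage hVo
  refine ⟨e.source ∩ e ⁻¹' V, hUo.mem_nhds ⟨hxs, hxV⟩, ?_⟩
  refine (riemannianVolume_le_chartVolume x hUo inter_subset_left).trans_lt ?_
  rw [chartVolume_apply x hUo.measurableSet]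
  have hsub : e.target ∩ e.symm ⁻¹' (e.source ∩ e ⁻¹' V) ⊆ V := by
    rintro y ⟨hy, -, hyV⟩
    simpa [e.right_inv hy] using hyV
  calc ∫⁻ y in e.target ∩ e.symm ⁻¹' (e.source ∩ e ⁻¹' V), ENNReal.ofReal (volumeDensity x y)
      ≤ ∫⁻ y in V, ENNReal.ofReal (volumeDensity x y) := lintegral_mono_set hsub
    _ ≤ ∫⁻ _ in V, ENNReal.ofReal (volumeDensity x (e x) + 1) :=
        setLIntegral_mono' hVo.measurableSet fun y hy =>
          ENNReal.ofReal_le_ofReal (hVsub hy).1.1.le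
    _ = ENNReal.ofReal (volumeDensity x (e x) + 1) * volume V := setLIntegral_const _ _
    _ < ⊤ := ENNReal.mul_lt_top ENNReal.ofReal_lt_top
        ((measure_mono fun y hy => (hVsub hy).2).trans_lt measure_ball_lt_top)

/-- A single chart suffices, since its volume is below the supremum: near the centre the density
exceeds half of its positive central value. -/
instance isOpenPosMeasure_riemannianVolume :
    (riemannianVolume m M).IsOpenPosMeasure := by
  refine ⟨fun U hU ⟨x, hxU⟩ => ?_⟩
  set e := chartAt (EuclideanSpace ℝ (Fin m)) x with he
  have hxs : x ∈ e.source := mem_chart_source _ x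
  have het : e x ∈ e.target := e.map_source hxs
  have hpos := volumeDensity_pos x het
  have hcont : ContinuousAt (volumeDensity x) (e x) :=
    (continuousOn_volumeDensity x).continuousAt (e.open_target.mem_nhds het)
  have hbd : ∀ᶠ y in 𝓝 (e x), volumeDensity x (e x) / 2 < volumeDensity x y :=
    continuousAt_const.eventually_lt hcont (half_lt_self hpos)
  have hpre : e.symm ⁻¹' U ∈ 𝓝 (e x) := (e.continuousAt_symm het).preimage_mem_nhds
    (by rw [e.left_inv hxs]; exact hU.mem_nhds hxU)
  obtain ⟨V, hVsub, hVo, hxV⟩ := mem_nhds_iff.1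
    (inter_mem (inter_mem hbd (e.open_target.mem_nhds het)) hpre)
  have hlow : 0 < chartVolume (m := m) x U := by
    rw [chartVolume_apply x hU.measurableSet]
    calc 0 < ENNReal.ofReal (volumeDensity x (e x) / 2) * volume V :=
          ENNReal.mul_pos (by simpa using half_pos hpos) (hVo.measure_pos volume ⟨_, hxV⟩).ne'
      _ = ∫⁻ _ in V, ENNReal.ofReal (volumeDensity x (e x) / 2) := (setLIntegral_const _ _).symm
      _ ≤ ∫⁻ y in V, ENNReal.ofReal (volumeDensity x y) :=
          setLIntegral_mono' hVo.measurableSet fun y hy =>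
            ENNReal.ofReal_le_ofReal (hVsub hy).1.1.le
      _ ≤ ∫⁻ y in e.target ∩ e.symm ⁻¹' U, ENNReal.ofReal (volumeDensity x y) :=
          lintegral_mono_set fun y hy => ⟨(hVsub hy).1.2, (hVsub hy).2⟩
  have hle : chartVolume (m := m) x ≤ riemannianVolume m M :=
    le_iSup (fun x : M => chartVolume (m := m) x) x
  exact (hlow.trans_le (hle U)).ne'

end Volume

/-! ### Energy density, scaling and constancy -/

section Energy

variable {m n : ℕ} {M : Type*} [TopologicalSpace M] [ChartedSpace (EuclideanSpace ℝ (Fin m)) M]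

section

variable [RiemannianBundle (fun x : M => TangentSpace (𝓡 m) x)]

theorem hilbertSchmidtSq_nonneg (f : M → EuclideanSpace ℝ (Fin n)) (x : M) :
    0 ≤ hilbertSchmidtSq m n f x :=
  Finset.sum_nonneg fun _ _ => sq_nonneg _

/-- The Hilbert–Schmidt norm, with the flat norm of the Euclidean target. -/
theorem hilbertSchmidtSq_eq_sum (f : M → EuclideanSpace ℝ (Fin n)) (x : M) :
    hilbertSchmidtSq m n f x = ∑ i, ‖(show EuclideanSpace ℝ (Fin n) from mfderiv (𝓡 m) (𝓡 n) f x
      (stdOrthonormalBasis ℝ (TangentSpace (𝓡 m) x) i))‖ ^ 2 :=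
  Finset.sum_congr rfl fun _ _ => congrArg (· ^ 2) norm_tangentSpace_vectorSpace

theorem mfderiv_eq_zero_of_hilbertSchmidtSq_eq_zero {f : M → EuclideanSpace ℝ (Fin n)} {x : M}
    (h : hilbertSchmidtSq m n f x = 0) : mfderiv (𝓡 m) (𝓡 n) f x = 0 := by
  have h1 := (Finset.sum_eq_zero_iff_of_nonneg fun _ _ => sq_nonneg _).1 h
  ext1 v
  rw [← (stdOrthonormalBasis ℝ (TangentSpace (𝓡 m) x)).sum_repr v, map_sum]
  refine Finset.sum_eq_zero fun i hi => ?_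
  have h2 := h1 i hi
  rw [map_smul, norm_eq_zero.1 (pow_eq_zero_iff two_ne_zero |>.1 h2), smul_zero]

theorem hilbertSchmidtSq_const_smul {f : M → EuclideanSpace ℝ (Fin n)} {x : M}
    (hf : MDifferentiableAt (𝓡 m) (𝓡 n) f x) (c : ℝ) :
    hilbertSchmidtSq m n (c • f) x = c ^ 2 * hilbertSchmidtSq m n f x := by
  rw [hilbertSchmidtSq_eq_sum, hilbertSchmidtSq_eq_sum, Finset.mul_sum]
  refine Finset.sum_congr rfl fun i _ => ?_
  rw [const_smul_mfderiv hf c, ← sq_abs c, ← Real.norm_eq_abs, ← mul_pow]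
  exact congrArg (· ^ 2) (norm_smul (β := EuclideanSpace ℝ (Fin n)) c _)

variable [IsManifold (𝓡 m) ∞ M]

/-- The matrix `⟨∂_i f, ∂_j f⟩` of a map in the chart around `x`. -/
def chartPullbackGram (f : M → EuclideanSpace ℝ (Fin n)) (x : M) (y : EuclideanSpace ℝ (Fin m)) :
    Matrix (Fin m) (Fin m) ℝ :=
  Matrix.of fun i j => inner ℝ
    (fderiv ℝ (f ∘ (chartAt (EuclideanSpace ℝ (Fin m)) x).symm) y
      (EuclideanSpace.single i (1 : ℝ)))
    (fderiv ℝ (f ∘ (chartAt (EuclideanSpace ℝ (Fin m)) x).symm) y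
      (EuclideanSpace.single j (1 : ℝ)))

theorem hilbertSchmidtSq_chart {f : M → EuclideanSpace ℝ (Fin n)}
    (hf : ContMDiff (𝓡 m) (𝓡 n) ∞ f) (x : M) {y : EuclideanSpace ℝ (Fin m)}
    (hy : y ∈ (chartAt (EuclideanSpace ℝ (Fin m)) x).target) :
    hilbertSchmidtSq m n f ((chartAt (EuclideanSpace ℝ (Fin m)) x).symm y) =
      ((chartGram x y)⁻¹ * chartPullbackGram f x y).trace := by
  set e := chartAt (EuclideanSpace ℝ (Fin m)) x with he
  have hchain : fderiv ℝ (f ∘ e.symm) y =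
      (mfderiv (𝓡 m) (𝓡 n) f (e.symm y)).comp (mfderiv (𝓡 m) (𝓡 m) e.symm y) := by
    rw [← mfderiv_eq_fderiv]
    exact mfderiv_comp y (hf.mdifferentiableAt (by simp))
      ((mdifferentiable_chart x).mdifferentiableAt_symm hy)
  have hrank : Module.finrank ℝ (TangentSpace (𝓡 m) (e.symm y)) = m :=
    finrank_euclideanSpace_fin (𝕜 := ℝ) (n := m)
  have key := sum_norm_sq_eq_trace
    ((stdOrthonormalBasis ℝ (TangentSpace (𝓡 m) (e.symm y))).reindex (finCongr hrank))
    (fun i => mfderiv (𝓡 m) (𝓡 m) e.symm y (EuclideanSpace.single i (1 : ℝ)))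
    (W := EuclideanSpace ℝ (Fin n)) (mfderiv (𝓡 m) (𝓡 n) f (e.symm y)).toLinearMap
    (det_chartGram_pos x hy).ne'
  unfold chartPullbackGram
  rw [hchain]
  refine Eq.trans ?_ key
  rw [← (finCongr hrank).sum_comp]
  simp only [OrthonormalBasis.reindex_apply, finCongr_symm, finCongr_apply, Fin.cast_cast, Fin.cast_eq_self]
  exact hilbertSchmidtSq_eq_sum f _

/-- The orthonormal bases in the definition are chosen pointwise with no continuity, so the
basis-free expression `tr (G⁻¹ F)` in a chart is used instead. -/
theorem continuous_hilbertSchmidtSq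
    [IsContinuousRiemannianBundle (EuclideanSpace ℝ (Fin m)) (fun x : M => TangentSpace (𝓡 m) x)]
    {f : M → EuclideanSpace ℝ (Fin n)} (hf : ContMDiff (𝓡 m) (𝓡 n) ∞ f) :
    Continuous (hilbertSchmidtSq m n f) := by
  refine continuous_iff_continuousAt.2 fun x => ?_
  set e := chartAt (EuclideanSpace ℝ (Fin m)) x with he
  have hxs : x ∈ e.source := mem_chart_source _ x
  have hnt : e.target ∈ 𝓝 (e x) := e.open_target.mem_nhds (e.map_source hxs)
  have hsm : ContDiffOn ℝ ∞ (f ∘ e.symm) e.target :=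
    (hf.comp_contMDiffOn contMDiffOn_chart_symm).contDiffOn
  have hfd : ContinuousOn (fderiv ℝ (f ∘ e.symm)) e.target :=
    hsm.continuousOn_fderiv_of_isOpen e.open_target (by simp)
  have hF : ContinuousAt (chartPullbackGram f x) (e x) := by
    refine continuousAt_pi.2 fun i => continuousAt_pi.2 fun j => ?_
    have h := hfd.continuousAt hnt
    exact (h.clm_apply continuousAt_const).inner (𝕜 := ℝ) (h.clm_apply continuousAt_const)
  have hG : ContinuousAt (chartGram x) (e x) := (continuousOn_chartGram x).continuousAt hnt
  have hdet : ContinuousAt (fun y => (chartGram x y).det) (e x) :=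
    (Continuous.matrix_det continuous_id).continuousAt.comp hG
  have hGinv : ContinuousAt (fun y => (chartGram x y)⁻¹) (e x) := by
    simp only [Matrix.inv_def, Ring.inverse_eq_inv']
    exact (hdet.inv₀ (det_chartGram_pos x (e.map_source hxs)).ne').smul
      ((Continuous.matrix_adjugate continuous_id).continuousAt.comp hG)
  have hT : ContinuousAt (fun y => ((chartGram x y)⁻¹ * chartPullbackGram f x y).trace) (e x) := by
    have hc : Continuous fun p : Matrix (Fin m) (Fin m) ℝ × Matrix (Fin m) (Fin m) ℝ =>
        (p.1 * p.2).trace := (continuous_fst.matrix_mul continuous_snd).matrix_trace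
    exact ContinuousAt.comp (f := fun y => ((chartGram x y)⁻¹, chartPullbackGram f x y))
      hc.continuousAt (hGinv.prodMk hF)
  refine (hT.comp (e.continuousAt hxs)).congr ?_
  filter_upwards [e.open_source.mem_nhds hxs] with z hz
  have h := hilbertSchmidtSq_chart hf x (e.map_source hz)
  rw [← he, e.left_inv hz] at h
  exact h.symm

variable [MeasurableSpace M]

omit [IsManifold (𝓡 m) ∞ M] in
/-- A harmonic map from a closed manifold to a Euclidean space has zero energy: scale it. -/
theorem dirichletEnergy_eq_zero_of_isHarmonic [CompactSpace M] {f : M → EuclideanSpace ℝ (Fin n)}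
    (hf : IsHarmonic m n f) : dirichletEnergy m n univ f = 0 := by
  have hsmooth : ContMDiff (𝓘(ℝ, ℝ).prod (𝓡 m)) (𝓡 n) ∞
      (fun p : ℝ × M => ((1 + p.1) • f) p.2) := by
    have h1 : ContMDiff (𝓘(ℝ, ℝ).prod (𝓡 m)) 𝓘(ℝ, ℝ) ∞ (fun p : ℝ × M => 1 + p.1) :=
      contMDiff_const.add contMDiff_fst
    exact h1.smul (hf.1.comp contMDiff_snd)
  -- With `K = univ` the condition outside `K` is vacuous.
  have hd := hf.2 (fun t => (1 + t) • f) univ hsmooth (by simp) isCompact_univ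
    (fun _ x hx => absurd (mem_univ x) hx)
  have hE : (fun t : ℝ => dirichletEnergy m n univ ((1 + t) • f)) =
      fun t => (1 + t) ^ 2 * dirichletEnergy m n univ f := by
    funext t
    unfold dirichletEnergy
    simp only [hilbertSchmidtSq_const_smul (hf.1.mdifferentiableAt (by simp)),
      integral_const_mul]
    ring
  rw [hE] at hd
  have hd2 : HasDerivAt (fun t : ℝ => (1 + t) ^ 2 * dirichletEnergy m n univ f)
      (2 * dirichletEnergy m n univ f) 0 := by
    have h := (((hasDerivAt_id (0 : ℝ)).const_add 1).pow 2).mul_const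
      (dirichletEnergy m n univ f)
    simpa using h
  linarith [hd.unique hd2]

theorem mfderiv_eq_zero_of_isHarmonic [BorelSpace M]
    [IsContinuousRiemannianBundle (EuclideanSpace ℝ (Fin m)) (fun x : M => TangentSpace (𝓡 m) x)]
    [T2Space M] [CompactSpace M] {f : M → EuclideanSpace ℝ (Fin n)} (hf : IsHarmonic m n f) (x : M) :
    mfderiv (𝓡 m) (𝓡 n) f x = 0 := by
  have hc := continuous_hilbertSchmidtSq hf.1
  have hE := dirichletEnergy_eq_zero_of_isHarmonic hf
  unfold dirichletEnergy at hE
  rw [Measure.restrict_univ] at hE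
  -- Needed because the integral of a non-integrable function is `0` by convention, so that a zero
  -- integral alone would say nothing.
  have hint : Integrable (hilbertSchmidtSq m n f) (riemannianVolume m M) := by
    rw [← integrableOn_univ]
    exact hc.continuousOn.integrableOn_compact isCompact_univ
  have h0 : hilbertSchmidtSq m n f =ᵐ[riemannianVolume m M] 0 :=
    (integral_eq_zero_iff_of_nonneg (hilbertSchmidtSq_nonneg f) hint).1 (by linarith)
  exact mfderiv_eq_zero_of_hilbertSchmidtSq_eq_zero
    (congrFun ((hc.ae_eq_iff_eq _ continuous_zero).1 h0) x)

end

/-- A smooth Riemannian metric is continuous. -/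
theorem isContinuousRiemannianBundle_of_isContMDiff [IsManifold (𝓡 m) ∞ M]
    [RiemannianBundle (fun x : M => TangentSpace (𝓡 m) x)]
    [h : IsContMDiffRiemannianBundle (𝓡 m) ∞ (EuclideanSpace ℝ (Fin m))
      (fun x : M => TangentSpace (𝓡 m) x)] :
    IsContinuousRiemannianBundle (EuclideanSpace ℝ (Fin m))
      (fun x : M => TangentSpace (𝓡 m) x) := by
  obtain ⟨g, hg, hgi⟩ := h.exists_contMDiff
  exact ⟨g, hg.continuous, hgi⟩

theorem compactSpace_of_isProperMap_of_isBounded {X E : Type*} [TopologicalSpace X]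
    [PseudoMetricSpace E] [ProperSpace E] {f : X → E} (hf : IsProperMap f)
    (hb : Bornology.IsBounded (range f)) : CompactSpace X := by
  refine ⟨?_⟩
  have h := hf.isCompact_preimage hb.isCompact_closure
  rwa [eq_univ_of_forall (s := f ⁻¹' closure (range f))
    fun x => subset_closure (mem_range_self x)] at h

/-- In a chart, `f` has zero derivative on a ball, which is convex, so `f` is locally constant;
connectedness does the rest. -/
theorem eq_of_mfderiv_eq_zero [IsManifold (𝓡 m) ∞ M] [PreconnectedSpace M]
    {f : M → EuclideanSpace ℝ (Fin n)} (hf : ContMDiff (𝓡 m) (𝓡 n) ∞ f)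
    (h : ∀ x, mfderiv (𝓡 m) (𝓡 n) f x = 0) (x y : M) : f x = f y := by
  refine IsLocallyConstant.apply_eq_of_preconnectedSpace ?_ x y
  refine (IsLocallyConstant.iff_eventually_eq f).2 fun x => ?_
  set e := chartAt (EuclideanSpace ℝ (Fin m)) x with he
  have hxs : x ∈ e.source := mem_chart_source _ x
  obtain ⟨r, hr, hball⟩ := Metric.isOpen_iff.1 e.open_target (e x) (e.map_source hxs)
  have hder : ∀ w ∈ Metric.ball (e x) r, HasFDerivAt (f ∘ e.symm)
      (0 : EuclideanSpace ℝ (Fin m) →L[ℝ] EuclideanSpace ℝ (Fin n)) w := by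
    intro w hw
    have h1 : MDifferentiableAt (𝓡 m) (𝓡 n) f (e.symm w) := hf.mdifferentiableAt (by simp)
    have h2 : MDifferentiableAt (𝓡 m) (𝓡 m) e.symm w :=
      (mdifferentiable_chart x).mdifferentiableAt_symm (hball hw)
    have h3 : fderiv ℝ (f ∘ e.symm) w = 0 := by
      rw [← mfderiv_eq_fderiv, mfderiv_comp w h1 h2, h]
      rfl
    rw [← h3]
    exact (h1.comp w h2).differentiableAt.hasFDerivAt
  filter_upwards [(e.continuousAt hxs).preimage_mem_nhds (Metric.ball_mem_nhds _ hr),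
    e.open_source.mem_nhds hxs] with z hz hzs
  have := (convex_ball (e x) r).is_const_of_fderivWithin_eq_zero (𝕜 := ℝ) (f := f ∘ e.symm)
    (fun w hw => (hder w hw).differentiableAt.differentiableWithinAt)
    (fun w hw => ((hder w hw).hasFDerivWithinAt).fderivWithin
      (Metric.isOpen_ball.uniqueDiffWithinAt hw)) hz (Metric.mem_ball_self hr)
  simpa [e.left_inv hzs, e.left_inv hxs] using this

end Energy

end HarmonicMaps

end

/-! ### The two statements -/

theorem corollary2p3 (n : ℕ) (hn : 1 < n) :
    (∀ (m : ℕ) (M : Type*) [EMetricSpace M] [ChartedSpace (EuclideanSpace ℝ (Fin m)) M]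
        [IsManifold (𝓡 m) ∞ M] [RiemannianBundle (fun x : M => TangentSpace (𝓡 m) x)]
        [IsContMDiffRiemannianBundle (𝓡 m) ∞ (EuclideanSpace ℝ (Fin m))
          (fun x : M => TangentSpace (𝓡 m) x)]
        [IsRiemannianManifold (𝓡 m) M] [CompleteSpace M] [ConnectedSpace M]
        [MeasurableSpace M] [BorelSpace M]
        (B : Set (EuclideanSpace ℝ (Fin n))) (f : M → EuclideanSpace ℝ (Fin n)),
        IsOpen B → Bornology.IsBounded B →
        HarmonicMaps.IsHarmonic m n f → IsProperMap f → (∀ x, f x ∈ B) →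
        ∃ c, ∀ x, f x = c) ∧
    (∀ (m : ℕ) (M : Type*) [TopologicalSpace M] [T2Space M] [SecondCountableTopology M]
        [ChartedSpace (EuclideanSpace ℝ (Fin m)) M] [IsManifold (𝓡 m) ∞ M] [ConnectedSpace M]
        [MeasurableSpace M] [BorelSpace M] (f : M → EuclideanSpace ℝ (Fin n)),
        1 ≤ m → HarmonicMaps.IsMinimalImmersion m n f → IsProperMap f →
        ¬ Bornology.IsBounded (Set.range f)) := by
  refine ⟨?_, ?_⟩
  · intro m M _ _ _ _ _ _ _ _ _ _ B f _ hB hf hp hfB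
    have : CompactSpace M := HarmonicMaps.compactSpace_of_isProperMap_of_isBounded hp
      (hB.subset (Set.range_subset_iff.2 hfB))
    have := HarmonicMaps.isContinuousRiemannianBundle_of_isContMDiff (m := m) (M := M)
    obtain ⟨x₀⟩ := (inferInstance : Nonempty M)
    exact ⟨f x₀, fun x => HarmonicMaps.eq_of_mfderiv_eq_zero hf.1 (HarmonicMaps.mfderiv_eq_zero_of_isHarmonic hf) x x₀⟩
  · intro m M _ _ _ _ _ _ _ _ f hm hf hp hb
    have : CompactSpace M := HarmonicMaps.compactSpace_of_isProperMap_of_isBounded hp hb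
    obtain ⟨-, hinj, g, -, hh⟩ := hf
    let _ : RiemannianBundle (fun x : M => TangentSpace (𝓡 m) x) := ⟨g.toRiemannianMetric⟩
    have := HarmonicMaps.isContinuousRiemannianBundle_of_isContMDiff (m := m) (M := M)
    obtain ⟨x₀⟩ := (inferInstance : Nonempty M)
    have h0 := HarmonicMaps.mfderiv_eq_zero_of_isHarmonic hh x₀
    -- Here `1 ≤ m` supplies a nonzero tangent vector, which the zero differential kills, against
    -- injectivity.
    have hv : (EuclideanSpace.single (⟨0, hm⟩ : Fin m) (1 : ℝ)) = 0 :=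
      hinj x₀ (by rw [h0]; rfl)
    simpa using congrArg norm hv
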